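/- **Setting.** Let $\mathcal A$ be an alphabet (a set of letters, finite or infinite), and let $\mathtt P$ be the following naive matcher, where variables $\mathtt s$ range over letters, $\mathtt p,\mathtt y,\mathtt q,\mathtt z$ range over words, and the first matching rule of a function is applied: - $S$: (1) $\mathtt s_a{:}\mathtt p,\ \mathtt s_a{:}\mathtt y \to L(\mathtt s_a{:}\mathtt p,\ \mathtt s_a{:}\mathtt y,\ \mathtt s_a{:}\mathtt p,\ \mathtt y)$; (2) $\mathtt s_a{:}\mathtt p,\ \mathtt s_b{:}\mathtt y \to S(\mathtt s_a{:}\mathtt p,\ \mathtt y)$; (3) $\mathtt p,\ \mathrm{Nil} \to \mathbf F$. - $L$: (1) $\mathtt s_a{:}\mathtt p,\ \mathtt s_a{:}\mathtt y,\ \mathtt q,\ \mathtt z \to L(\mathtt p,\mathtt y,\mathtt q,\mathtt z)$; (2) $\mathtt s_a{:}\mathtt p,\ \mathtt s_b{:}\mathtt y,\ \mathtt q,\ \mathtt z \to S(\mathtt q,\mathtt z)$; (3) $\mathtt s_a{:}\mathtt p,\ \mathrm{Nil},\ \mathtt q,\ \mathtt z \to S(\mathtt q,\mathtt z)$; (4)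 $\mathrm{Nil},\ \mathtt y,\ \mathtt q,\ \mathtt z \to \mathbf T$. A *configuration* is an expression (a function call whose arguments may contain parameters for letters and for words, or $\mathbf T$, or $\mathbf F$) together with *negative information*, a finite conjunction of inequalities between letter parameters of the expression and letters or such parameters. The *one-step unfolding* of a configuration applies the program once, splitting parameters into cases where matching requires it (a word parameter is $\mathrm{Nil}$ or $\#s{:}\#y$; a letter parameter is equal or unequal to a given letter or letter parameter, the inequality being added to the negative information). Cases with unsatisfiable negative information are discarded. The result is a finite set of outgoing edges, each marked with the number of the rule applied. A node is *transient* if it has exactly one outgoing edge, and a *pivot* if it has at least two. For $\pi\in\mathcal A^{+}$ let $\hat{\mathtt P}_\pi$ be the complete (finite or infinite) unfolding tree of $S(\pi,\#y)$, where $\#y$ is a word parameter: its root is $S(\pi,\#y)$ without negative information, one-step unfolding is applied to all nodes without end, and all transient nodes are removed (their incoming and outgoing edges being composed). Paths from the root are ordered lexicographically by the numbers of the rules applied. A configuration $C_1$ *covers* $C_2$ if some renaming $\sigma$ of parameters takes the expression of $C_1$ to that of $C_2$, and the negative information of $C_2$ implies the $\sigma$-renamed negative information of $C_1$ for all values of the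 parameters. A segment $\Psi$ of a path *covers* a subtree $H$ if every infinite path starting at the root of $H$ contains a configuration covered by some configuration along $\Psi$. **Theorem (On Covering).** Let $\pi\in\mathcal A^{+}$. Then $\hat{\mathtt P}_\pi$ has a first path $\mathfrak t$ from the root to a leaf labelled $\mathbf T$. No path from the root to a leaf labelled $\mathbf T$ is shorter than $\mathfrak t$. Every nonempty prefix $\Psi$ of $\mathfrak t$ (one that contains at least the root) contains a pivot configuration, and if $[C]$ is the last one, then $\Psi$ covers every subtree $H$ of $\hat{\mathtt P}_\pi$ that is rooted at a child of $[C]$ not belonging to $\mathfrak t$. Consequently, every infinite path of $\hat{\mathtt P}_\pi$ starting at the root contains a configuration covered by an earlier configuration of the same path, and there are finitely many configurations in $\hat{\mathtt P}_\pi$ up to parameter renaming (two configurations being identified if each covers the other). -/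

import Mathlib

namespace Unfolding

/-! ### Terms, configurations, programs -/

/-- A symbol position: a letter of the alphabet, or an `s`-parameter (in a program rule: an
`s`-variable), which ranges over the letters. -/
inductive STerm (A : Type*) where
  | sym (a : A)
  | par (i : ℕ)
  deriving DecidableEq

/-- A parameterized list (in a program rule: a list pattern). `var i` is a list parameter
(in a rule: a list variable), which ranges over the words. -/
inductive LTerm (A : Type*) where
  | nil
  | cons (s : STerm A) (t : LTerm A)
  | var (i : ℕ)
  deriving DecidableEq

/-- The function names of the matcher. -/
inductive Fn where
  | S
  | L

/-- Parameterized expressions of a tail recursive program: a call, or one of the constants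
true and false. -/
inductive Expr (A : Type*) where
  | call (f : Fn) (args : List (LTerm A))
  | tt
  | ff

/-- `lhs` are the patterns of the arguments, `rhs` is the right-hand side. `s`-variables may
be repeated in `lhs`; list variables are not repeated there. -/
structure Rule (A : Type*) where
  lhs : List (LTerm A)
  rhs : Expr A

/-- The ordered list of rules of every function. The first rule that matches is applied. -/
abbrev Program (A : Type*) := Fn → List (Rule A)

/-- Negative information: the conjunction of the inequalities `a ≠ b` for `(a, b)` in the
list. -/
abbrev NegInfo (A : Type*) := List (STerm A × STerm A)

/-- A parameterized configuration: an expression with negative information. -/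
structure Config (A : Type*) where
  expr : Expr A
  neg : NegInfo A

/-! ### Values of parameters, substitutions -/

def STerm.value {A : Type*} (v : ℕ → A) : STerm A → A
  | .sym a => a
  | .par i => v i

/-- The negative information is true for the values `v` of the `s`-parameters. -/
def NegInfo.Holds {A : Type*} (v : ℕ → A) (R : NegInfo A) : Prop :=
  ∀ q ∈ R, q.1.value v ≠ q.2.value v

def NegInfo.Satisfiable {A : Type*} (R : NegInfo A) : Prop :=
  ∃ v : ℕ → A, R.Holds v

/-- Simultaneous substitution `σ` for the `s`-parameters. -/
def STerm.subst {A : Type*} (σ : ℕ → STerm A) : STerm A → STerm A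
  | .sym a => .sym a
  | .par i => σ i

/-- Simultaneous substitution `σ` for the `s`-parameters and `τ` for the list parameters. -/
def LTerm.subst {A : Type*} (σ : ℕ → STerm A) (τ : ℕ → LTerm A) : LTerm A → LTerm A
  | .nil => .nil
  | .cons s t => .cons (s.subst σ) (t.subst σ τ)
  | .var i => τ i

def Expr.subst {A : Type*} (σ : ℕ → STerm A) (τ : ℕ → LTerm A) : Expr A → Expr A
  | .call f args => .call f (args.map (LTerm.subst σ τ))
  | .tt => .tt
  | .ff => .ff

def NegInfo.subst {A : Type*} (σ : ℕ → STerm A) (R : NegInfo A) : NegInfo A :=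
  R.map fun q => (q.1.subst σ, q.2.subst σ)

def Config.subst {A : Type*} (σ : ℕ → STerm A) (τ : ℕ → LTerm A) (C : Config A) : Config A :=
  ⟨C.expr.subst σ τ, NegInfo.subst σ C.neg⟩

/-- The narrowing that replaces the list parameter `i` by `t`. -/
def Config.narrowList {A : Type*} (C : Config A) (i : ℕ) (t : LTerm A) : Config A :=
  C.subst STerm.par (Function.update LTerm.var i t)

/-- The narrowing that replaces the `s`-parameter `i` by `b`. -/
def Config.narrowSym {A : Type*} (C : Config A) (i : ℕ) (b : STerm A) : Config A :=
  C.subst (Function.update STerm.par i b) LTerm.var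

/-- The restriction that adds the inequality `a ≠ b`. -/
def Config.addNe {A : Type*} (C : Config A) (a b : STerm A) : Config A :=
  ⟨C.expr, (a, b) :: C.neg⟩

/-! ### The `s`-parameters that occur in an object -/

def STerm.params {A : Type*} : STerm A → List ℕ
  | .sym _ => []
  | .par i => [i]

def LTerm.params {A : Type*} : LTerm A → List ℕ
  | .nil => []
  | .cons s t => s.params ++ t.params
  | .var _ => []

def Expr.params {A : Type*} : Expr A → List ℕ
  | .call _ args => args.flatMap LTerm.params
  | .tt => []
  | .ff => []

def NegInfo.params {A : Type*} (R : NegInfo A) : List ℕ :=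
  R.flatMap fun q => q.1.params ++ q.2.params

/-- An index of an `s`-parameter that does not occur in the configuration. -/
def Config.fresh {A : Type*} (C : Config A) : ℕ :=
  (C.expr.params ++ C.neg.params).foldr (fun i n => max (i + 1) n) 0

/-- Keep only the negative information about the parameters of the expression. Inequalities
between two letters say nothing about the parameters and are dropped too. -/
def Config.restrict {A : Type*} (C : Config A) : Config A :=
  ⟨C.expr, C.neg.filter fun q =>
    q.1.params ++ q.2.params ≠ [] ∧ ∀ i ∈ q.1.params ++ q.2.params, i ∈ C.expr.params⟩

/-! ### Matching a parameterized configuration against the rules -/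

/-- Values of the variables of a rule, as far as they are known. -/
structure Env (A : Type*) where
  sval : ℕ → Option (STerm A)
  lval : ℕ → Option (LTerm A)

def Env.empty (A : Type*) : Env A := ⟨fun _ => none, fun _ => none⟩

def Env.bindSym {A : Type*} (ρ : Env A) (v : ℕ) (a : STerm A) : Env A :=
  ⟨Function.update ρ.sval v (some a), ρ.lval⟩

def Env.bindList {A : Type*} (ρ : Env A) (v : ℕ) (t : LTerm A) : Env A :=
  ⟨ρ.sval, Function.update ρ.lval v (some t)⟩

/-- The right-hand side of a rule for the values `ρ` of its variables. -/
def Expr.instantiate {A : Type*} (ρ : Env A) (e : Expr A) : Expr A :=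
  e.subst (fun v => (ρ.sval v).getD (.par v)) (fun v => (ρ.lval v).getD (.var v))

/-- The result of matching: success; failure for all values of the parameters; or the first
question about the parameters whose answer is needed in order to go on, namely whether the list
parameter `i` is empty, or whether the `s`-parameter `i` is equal to `b`. -/
inductive MatchResult (A : Type*) where
  | yes (ρ : Env A)
  | no
  | askList (i : ℕ)
  | askSym (i : ℕ) (b : STerm A)

/-- Compare two symbol positions, given the negative information `R`. -/
def compareSym {A : Type*} [DecidableEq A] (R : NegInfo A) (ρ : Env A) (a b : STerm A) :
    MatchResult A :=
  if a = b then .yes ρ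
  else if (a, b) ∈ R ∨ (b, a) ∈ R then .no
  else match a, b with
    | .sym _, .sym _ => .no
    | .par i, b => .askSym i b
    | .sym a, .par i => .askSym i (.sym a)

def matchSym {A : Type*} [DecidableEq A] (R : NegInfo A) (p t : STerm A) (ρ : Env A) :
    MatchResult A :=
  match p with
  | .sym c => compareSym R ρ (.sym c) t
  | .par v =>
    match ρ.sval v with
    | none => .yes (ρ.bindSym v t)
    | some a => compareSym R ρ a t

def matchList {A : Type*} [DecidableEq A] (R : NegInfo A) :
    LTerm A → LTerm A → Env A → MatchResult A
  | .var v, t, ρ => .yes (ρ.bindList v t)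
  | .nil, .nil, ρ => .yes ρ
  | .nil, .cons _ _, _ => .no
  | .nil, .var i, _ => .askList i
  | .cons _ _, .nil, _ => .no
  | .cons _ _, .var i, _ => .askList i
  | .cons s p, .cons a t, ρ =>
    match matchSym R s a ρ with
    | .yes ρ' => matchList R p t ρ'
    | .no => .no
    | .askList i => .askList i
    | .askSym i b => .askSym i b

def matchArgs {A : Type*} [DecidableEq A] (R : NegInfo A) :
    List (LTerm A) → List (LTerm A) → Env A → MatchResult A
  | [], [], ρ => .yes ρ
  | [], _ :: _, _ => .no
  | _ :: _, [], _ => .no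
  | p :: ps, t :: ts, ρ =>
    match matchList R p t ρ with
    | .yes ρ' => matchArgs R ps ts ρ'
    | .no => .no
    | .askList i => .askList i
    | .askSym i b => .askSym i b

/-- What a configuration does next: it applies the rule number `k` with the result `e`; it needs
an answer about the parameters; or nothing at all (a passive configuration, or no rule matches). -/
inductive Action (A : Type*) where
  | apply (k : ℕ) (e : Expr A)
  | askList (i : ℕ)
  | askSym (i : ℕ) (b : STerm A)
  | halt

/-- Try the rules one after another; `k` is the number of the first one. -/
def tryRules {A : Type*} [DecidableEq A] (R : NegInfo A) (args : List (LTerm A)) :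
    List (Rule A) → ℕ → Action A
  | [], _ => .halt
  | r :: rs, k =>
    match matchArgs R r.lhs args (Env.empty A) with
    | .yes ρ => .apply k (r.rhs.instantiate ρ)
    | .no => tryRules R args rs (k + 1)
    | .askList i => .askList i
    | .askSym i b => .askSym i b

def action {A : Type*} [DecidableEq A] (P : Program A) (C : Config A) : Action A :=
  match C.expr with
  | .call f args => tryRules C.neg args (P f) 0
  | .tt => .halt
  | .ff => .halt

/-! ### The complete unfolding tree -/

/-- `Unfolds P C k D`: the tree generated by the one-step unfolding of `C` has a leaf `D` that
arises by the rule number `k`. Whenever matching needs to know more about a parameter, all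
possible cases with satisfiable negative information are considered. In the case of a nonempty
list the old list parameter disappears, and its name is used again for the tail. -/
inductive Unfolds {A : Type*} [DecidableEq A] (P : Program A) :
    Config A → ℕ → Config A → Prop where
  | apply {C : Config A} {k : ℕ} {e : Expr A} :
      action P C = .apply k e → Unfolds P C k (Config.restrict ⟨e, C.neg⟩)
  | empty {C D : Config A} {k i : ℕ} :
      action P C = .askList i → Unfolds P (C.narrowList i .nil) k D → Unfolds P C k D
  | nonempty {C D : Config A} {k i : ℕ} :
      action P C = .askList i →
      Unfolds P (C.narrowList i (.cons (.par C.fresh) (.var i))) k D → Unfolds P C k D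
  | eq {C D : Config A} {k i : ℕ} {b : STerm A} :
      action P C = .askSym i b → (C.narrowSym i b).neg.Satisfiable →
      Unfolds P (C.narrowSym i b) k D → Unfolds P C k D
  | ne {C D : Config A} {k i : ℕ} {b : STerm A} :
      action P C = .askSym i b → (C.addNe (.par i) b).neg.Satisfiable →
      Unfolds P (C.addNe (.par i) b) k D → Unfolds P C k D

/-- The one-step unfolding produces exactly one outgoing edge. -/
def Transient {A : Type*} [DecidableEq A] (P : Program A) (C : Config A) : Prop :=
  ∃! e : ℕ × Config A, Unfolds P C e.1 e.2

/-- The one-step unfolding produces at least two outgoing edges. -/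
def Pivot {A : Type*} [DecidableEq A] (P : Program A) (C : Config A) : Prop :=
  ∃ e e' : ℕ × Config A, e ≠ e' ∧ Unfolds P C e.1 e.2 ∧ Unfolds P C e'.1 e'.2

/-- The edges of the complete unfolding tree after the removal of all transient nodes. An edge is
labelled with the numbers of the rules applied along it. -/
inductive Edge {A : Type*} [DecidableEq A] (P : Program A) :
    Config A → List ℕ → Config A → Prop where
  | last {C D : Config A} {k : ℕ} :
      Unfolds P C k D → ¬ Transient P D → Edge P C [k] D
  | skip {C D E : Config A} {k : ℕ} {ks : List ℕ} :
      Unfolds P C k D → Transient P D → Edge P D ks E → Edge P C (k :: ks) E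

/-- A finite path that starts at a node labelled `C` is given by its edges, each with the
configuration at its end. A node of the tree is the same as a path from the root to it. The path
`[]` consists of its starting node. -/
abbrev TreePath (A : Type*) := List (List ℕ × Config A)

/-- `p` is a path of the complete unfolding tree with root `C`. -/
def IsPath {A : Type*} [DecidableEq A] (P : Program A) : Config A → TreePath A → Prop
  | _, [] => True
  | C, (ks, D) :: p => Edge P C ks D ∧ IsPath P D p

/-- The configuration at the end of a path. -/
def TreePath.target {A : Type*} : Config A → TreePath A → Config A
  | C, [] => C
  | _, (_, D) :: p => TreePath.target D p

/-- All configurations along a path, in order. -/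
def TreePath.configs {A : Type*} (C : Config A) (p : TreePath A) : List (Config A) :=
  C :: p.map Prod.snd

/-- The numbers of all rules applied along a path. -/
def TreePath.ruleNumbers {A : Type*} (p : TreePath A) : List ℕ :=
  p.flatMap Prod.fst

/-- An infinite path that starts at a node labelled `C`. -/
def IsInfinitePath {A : Type*} [DecidableEq A] (P : Program A) (C : Config A)
    (r : ℕ → Config A) : Prop :=
  r 0 = C ∧ ∀ n, ∃ ks, Edge P (r n) ks (r (n + 1))

/-- `p` leads from the root `C` to a leaf labelled with the constant true. -/
def IsTruePath {A : Type*} [DecidableEq A] (P : Program A) (C : Config A) (p : TreePath A) : Prop :=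
  IsPath P C p ∧ (TreePath.target C p).expr = .tt

/-- `p` is the first of the paths from the root to a leaf labelled with the constant true.
Paths are ordered lexicographically by the numbers of the applied rules. (Where two paths
separate, the called function is the same.) -/
def IsFirstTruePath {A : Type*} [DecidableEq A] (P : Program A) (C : Config A) (p : TreePath A) :
    Prop :=
  IsTruePath P C p ∧
    ∀ p' : TreePath A, IsTruePath P C p' → p' ≠ p →
      List.Lex (· < ·) (TreePath.ruleNumbers p) (TreePath.ruleNumbers p')

/-- The node at the end of `q` is the last pivot node along the path `Ψ`. -/
def IsLastPivot {A : Type*} [DecidableEq A] (P : Program A) (C : Config A) (q Ψ : TreePath A) :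
    Prop :=
  q <+: Ψ ∧ Pivot P (TreePath.target C q) ∧
    ∀ q' : TreePath A, q <+: q' → q' <+: Ψ → q' ≠ q → ¬ Pivot P (TreePath.target C q')

/-! ### Covering -/

/-- `C` covers `D`: a renaming of parameters (of `s`-parameters by `σ` and of list parameters
by `τ`) takes the expression of `C` to that of `D`, and the negative information of `D` implies
the renamed negative information of `C`. -/
def Config.Covers {A : Type*} (C D : Config A) : Prop :=
  ∃ σ τ : Equiv.Perm ℕ,
    C.expr.subst (fun i => .par (σ i)) (fun i => .var (τ i)) = D.expr ∧
    ∀ v : ℕ → A, D.neg.Holds v → (NegInfo.subst (fun i => .par (σ i)) C.neg).Holds v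

/-- A segment of a path, given by its configurations, covers the configuration `C`. -/
def SegmentCovers {A : Type*} (Δ : List (Config A)) (C : Config A) : Prop :=
  ∃ K ∈ Δ, K.Covers C

/-- A segment covers the subtree whose root is labelled `D`: along every infinite path from this
root there is a configuration covered by the segment. (The subtree below a node labelled `D` is
the complete unfolding tree of `D`.) -/
def SegmentCoversSubtree {A : Type*} [DecidableEq A] (P : Program A) (Δ : List (Config A))
    (D : Config A) : Prop :=
  ∀ r : ℕ → Config A, IsInfinitePath P D r → ∃ n, SegmentCovers Δ (r n)

/-! ### The naive matcher -/

/-- A word as a list without parameters. -/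
def LTerm.word {A : Type*} : List A → LTerm A
  | [] => .nil
  | a :: w => .cons (.sym a) (LTerm.word w)

/-- The naive matcher. Variables: `sᵃ = par 0`, `sᵇ = par 1`, `p = var 0`, `y = var 1`,
`q = var 2`, `z = var 3`.

`S { sᵃ:p, sᵃ:y = L(sᵃ:p, sᵃ:y, sᵃ:p, y);  sᵃ:p, sᵇ:y = S(sᵃ:p, y);  p, Nil = F }`

`L { sᵃ:p, sᵃ:y, q, z = L(p, y, q, z);  sᵃ:p, sᵇ:y, q, z = S(q, z);`
`    sᵃ:p, Nil, q, z = S(q, z);  Nil, y, q, z = T }` -/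
def naiveMatcher (A : Type*) : Program A
  | .S =>
    [ ⟨[.cons (.par 0) (.var 0), .cons (.par 0) (.var 1)],
        .call .L [.cons (.par 0) (.var 0), .cons (.par 0) (.var 1),
          .cons (.par 0) (.var 0), .var 1]⟩,
      ⟨[.cons (.par 0) (.var 0), .cons (.par 1) (.var 1)],
        .call .S [.cons (.par 0) (.var 0), .var 1]⟩,
      ⟨[.var 0, .nil], .ff⟩ ]
  | .L =>
    [ ⟨[.cons (.par 0) (.var 0), .cons (.par 0) (.var 1), .var 2, .var 3],
        .call .L [.var 0, .var 1, .var 2, .var 3]⟩,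
      ⟨[.cons (.par 0) (.var 0), .cons (.par 1) (.var 1), .var 2, .var 3],
        .call .S [.var 2, .var 3]⟩,
      ⟨[.cons (.par 0) (.var 0), .nil, .var 2, .var 3],
        .call .S [.var 2, .var 3]⟩,
      ⟨[.nil, .var 1, .var 2, .var 3], .tt⟩ ]

/-- The entry configuration `S(π, #y)`: static pattern `π`, dynamic string, no negative
information. -/
def entry {A : Type*} (π : List A) : Config A :=
  ⟨.call .S [LTerm.word π, .var 0], []⟩

end Unfolding

namespace Unfolding

variable {A : Type*}

/-! ### States of the matcher -/

/-! Every reachable configuration is described by a `State`: the part of the pattern already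
matched, the known letters of the string, and an ending with at most one letter parameter and one
word parameter. Their indices are always 0, so recurring configurations are literally equal and
covering needs only the identity renaming.

The main path is the one on which every letter asked for is the right one. Its nodes are `State.main
x v` with `x ++ v = π`, and each of them except the leaf is a pivot. Let the length of a state be
the number of letters it knows from the current alignment on, an unknown letter with inequalities
counting as one. Leaving the main path at `x` gives length at most `|x|`: the shift drops a letter
before at most one unknown letter is added (`State.Step.length_le_of_main`). Outside the main states
no step increases the length, and the measure `State.rank` decreases
(`State.Step.length_le_and_rank_lt`). Hence an infinite path must meet a main state again, the first
one being of length at most `|x|` (`State.Valid.exists_main`). A main state is determined by its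
length, so this one already lies on the main path at or before the branching point: this is the
covering statement.

An edge raises the length by at most one, and T is given length `|π|`, so no path to T is shorter
than the main path. The main path is first because its edges begin with rule number 0 and all edges
leaving it begin with a positive number. Finally, all reachable states satisfy `State.Valid`, which
only finitely many states do; finiteness and, by pigeonhole, the claim on infinite paths follow. -/

/-- The end of a dynamic string after its known letters: nothing, an unknown rest, or an unknown
letter, known to be different from the letters of `R`, before an unknown rest. -/
inductive Ending (A : Type*) where
  | nil
  | var
  | par (R : List A)

/-- The configurations that occur when a pattern is matched with an unknown string, up to the names
of parameters. In `call_L x v u e` the pattern is `x ++ v`, its part `x` has been matched already,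
and the string from the current alignment on is `x ++ u`, followed by `e`. -/
inductive State (A : Type*) where
  | call_S (w : List A) (e : Ending A)
  | call_L (x v u : List A) (e : Ending A)
  | tt
  | ff

/-- The known letters `w` followed by the list `t`. -/
def LTerm.prepend (w : List A) (t : LTerm A) : LTerm A :=
  w.foldr (fun a t => .cons (.sym a) t) t

@[simp] theorem LTerm.prepend_nil (t : LTerm A) : LTerm.prepend [] t = t := rfl

@[simp] theorem LTerm.prepend_cons (a : A) (w : List A) (t : LTerm A) :
    LTerm.prepend (a :: w) t = .cons (.sym a) (LTerm.prepend w t) := rfl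

def Ending.term : Ending A → LTerm A
  | .nil => .nil
  | .var => .var 0
  | .par _ => .cons (.par 0) (.var 0)

/-- Each pair has the orientation produced by `Config.addNe`, so adding an inequality is literally
passing from `R` to `a :: R`. -/
def Ending.neg : Ending A → NegInfo A
  | .par R => R.map fun a => (.par 0, .sym a)
  | _ => []

/-- The configuration described by a state, for the pattern `π`. -/
def State.config (π : List A) : State A → Config A
  | .call_S w e => ⟨.call .S [LTerm.word π, .prepend w e.term], e.neg⟩
  | .call_L x v u e =>
    ⟨.call .L [LTerm.word v, .prepend u e.term, LTerm.word π, .prepend (x ++ u).tail e.term], e.neg⟩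
  | .tt => ⟨.tt, []⟩
  | .ff => ⟨.ff, []⟩

/-- The transitions between the states, with the numbers of the applied rules. The satisfiability
of negative information is not taken into account. -/
inductive State.Step (π : List A) : State A → ℕ → State A → Prop
  | S_match {a p w e} : π = a :: p → Step π (.call_S (a :: w) e) 0 (.call_L [] π (a :: w) e)
  | S_mismatch {b w e} : Step π (.call_S (b :: w) e) 1 (.call_S w e)
  | S_nil : Step π (.call_S [] .nil) 2 .ff
  | S_par_eq {a p R} : π = a :: p → Step π (.call_S [] (.par R)) 0 (.call_L [] π [a] .var)
  | S_par_ne {R} : Step π (.call_S [] (.par R)) 1 (.call_S [] .var)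
  | S_var_nil : Step π (.call_S [] .var) 2 .ff
  | S_var_eq {a p} : π = a :: p → Step π (.call_S [] .var) 0 (.call_L [] π [a] .var)
  | S_var_ne : Step π (.call_S [] .var) 1 (.call_S [] .var)
  | L_done {x u e} : Step π (.call_L x [] u e) 3 .tt
  | L_match {x a v u e} :
      Step π (.call_L x (a :: v) (a :: u) e) 0 (.call_L (x ++ [a]) v u e)
  | L_mismatch {x a b v u e} :
      Step π (.call_L x (a :: v) (b :: u) e) 1 (.call_S (x ++ b :: u).tail e)
  | L_nil {x a v} : Step π (.call_L x (a :: v) [] .nil) 2 (.call_S x.tail .nil)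
  | L_par_known {x a v R} :
      Step π (.call_L x (a :: v) [] (.par R)) 1 (.call_S x.tail (.par R))
  | L_par_eq {x a v R} :
      Step π (.call_L x (a :: v) [] (.par R)) 0 (.call_L (x ++ [a]) v [] .var)
  | L_par_ne {x a v R} : a ∉ R →
      Step π (.call_L x (a :: v) [] (.par R)) 1 (.call_S x.tail (.par (a :: R)))
  | L_var_nil {x a v} : Step π (.call_L x (a :: v) [] .var) 2 (.call_S x.tail .nil)
  | L_var_eq {x a v} :
      Step π (.call_L x (a :: v) [] .var) 0 (.call_L (x ++ [a]) v [] .var)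
  | L_var_ne {x a v} : Step π (.call_L x (a :: v) [] .var) 1 (.call_S x.tail (.par [a]))

/-! ### Substitution and parameters -/

theorem LTerm.word_eq_prepend (w : List A) : LTerm.word w = LTerm.prepend w .nil := by
  induction w with
  | nil => rfl
  | cons a w ih => simp [LTerm.word, ih]

@[simp] theorem LTerm.subst_prepend (σ : ℕ → STerm A) (τ : ℕ → LTerm A) (w : List A) (t : LTerm A) :
    (LTerm.prepend w t).subst σ τ = LTerm.prepend w (t.subst σ τ) := by
  induction w with
  | nil => rfl
  | cons a w ih => simp [LTerm.subst, STerm.subst, ih]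

@[simp] theorem LTerm.params_prepend (w : List A) (t : LTerm A) :
    (LTerm.prepend w t).params = t.params := by
  induction w with
  | nil => rfl
  | cons a w ih => simp [LTerm.params, STerm.params, ih]

@[simp] theorem LTerm.subst_par_var (t : LTerm A) : t.subst STerm.par LTerm.var = t := by
  induction t with
  | nil => rfl
  | cons s t ih => cases s <;> simp [LTerm.subst, STerm.subst, ih]
  | var i => rfl

theorem NegInfo.subst_par (R : NegInfo A) : NegInfo.subst STerm.par R = R := by
  have h (s : STerm A) : s.subst STerm.par = s := by cases s <;> rfl
  simp [NegInfo.subst, h]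

theorem Config.covers_refl (C : Config A) : C.Covers C := by
  refine ⟨1, 1, ?_, fun v h => ?_⟩
  · have h (t : LTerm A) :
        t.subst (fun i => .par i) (fun i => .var i) = t := t.subst_par_var
    rcases C with ⟨_ | _ | _, R⟩ <;> simp [Expr.subst, List.map_id'' h]
  · exact (NegInfo.subst_par C.neg).symm ▸ h

theorem Config.restrict_map_par (f : Fn) (args : List (LTerm A))
    (R : List A) (h : 0 ∈ args.flatMap LTerm.params) :
    Config.restrict ⟨.call f args, R.map fun a => (STerm.par 0, STerm.sym a)⟩ =
      ⟨.call f args, R.map fun a => (STerm.par 0, STerm.sym a)⟩ := by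
  simp only [Config.restrict, Config.mk.injEq, true_and, List.filter_eq_self]
  rintro _ hq
  obtain ⟨a, -, rfl⟩ := List.mem_map.1 hq
  simpa [STerm.params, Expr.params] using h

/-- This also clears the inequalities between two letters that remain after a letter parameter has
been replaced by a letter. -/
theorem Config.restrict_eq_nil (E : Expr A) (R : NegInfo A) (h : E.params = []) :
    Config.restrict ⟨E, R⟩ = ⟨E, []⟩ := by
  simp only [Config.restrict, Config.mk.injEq, true_and, List.filter_eq_nil_iff, h]
  rintro q -
  simp only [List.not_mem_nil, imp_false, ne_eq, decide_eq_true_eq, not_and, not_forall]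
  intro hq
  obtain ⟨i, hi⟩ := List.exists_mem_of_ne_nil _ hq
  exact ⟨i, not_not.2 hi⟩

/-! ### Unfolding in terms of the next action -/

/-- Since `action` is a function, it decides which constructors can apply; unfolding becomes a
computation by rewriting. -/
theorem unfolds_iff [DecidableEq A] {P : Program A} {C D : Config A} {k : ℕ} :
    Unfolds P C k D ↔
      match action P C with
      | .apply k' e => k = k' ∧ D = Config.restrict ⟨e, C.neg⟩
      | .askList i => Unfolds P (C.narrowList i .nil) k D ∨
          Unfolds P (C.narrowList i (.cons (.par C.fresh) (.var i))) k D
      | .askSym i b =>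
          ((C.narrowSym i b).neg.Satisfiable ∧ Unfolds P (C.narrowSym i b) k D) ∨
          ((C.addNe (.par i) b).neg.Satisfiable ∧ Unfolds P (C.addNe (.par i) b) k D)
      | .halt => False := by
  constructor
  · intro h
    cases h with
    | apply h => simp [h]
    | empty h h' => simp [h, h']
    | nonempty h h' => simp [h, h']
    | eq h h' h'' => simp [h, h', h'']
    | ne h h' h'' => simp [h, h', h'']
  · intro h
    split at h
    · obtain ⟨rfl, rfl⟩ := h
      exact .apply ‹_›
    · exact h.elim (.empty ‹_›) (.nonempty ‹_›)
    · exact h.elim (fun h => .eq ‹_› h.1 h.2) (fun h => .ne ‹_› h.1 h.2)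
    · exact h.elim

/-! ### The actions of the naive matcher -/

section
variable [DecidableEq A]

theorem action_S_match (a : A) (p : List A) (t : LTerm A) (R : NegInfo A) :
    action (naiveMatcher A) ⟨.call .S [.word (a :: p), .cons (.sym a) t], R⟩ =
      .apply 0 (.call .L [.word (a :: p), .cons (.sym a) t, .word (a :: p), t]) := by
  simp [action, naiveMatcher, tryRules, matchArgs, matchList, matchSym, compareSym, Env.empty,
    Env.bindSym, Env.bindList, Expr.instantiate, Expr.subst, LTerm.subst, STerm.subst, LTerm.word,
    Function.update]

theorem action_S_mismatch {a b : A} (h : a ≠ b) (p : List A) (t : LTerm A) (R : NegInfo A) :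
    action (naiveMatcher A) ⟨.call .S [.word (a :: p), .cons (.sym b) t], R⟩ =
      .apply 1 (.call .S [.word (a :: p), t]) := by
  simp [h, action, naiveMatcher, tryRules, matchArgs, matchList, matchSym, compareSym, Env.empty,
    Env.bindSym, Env.bindList, Expr.instantiate, Expr.subst, LTerm.subst, STerm.subst, LTerm.word,
    Function.update]

theorem action_S_nil (p : List A) (R : NegInfo A) :
    action (naiveMatcher A) ⟨.call .S [.word p, .nil], R⟩ = .apply 2 .ff := by
  cases p <;> simp [action, naiveMatcher, tryRules, matchArgs, matchList, matchSym, Env.empty,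
    Env.bindSym, Env.bindList, Expr.instantiate, Expr.subst, LTerm.word]

theorem action_S_var (a : A) (p : List A) (i : ℕ) (R : NegInfo A) :
    action (naiveMatcher A) ⟨.call .S [.word (a :: p), .var i], R⟩ = .askList i := by
  simp [action, naiveMatcher, tryRules, matchArgs, matchList, matchSym, Env.empty,
    Env.bindSym, Env.bindList, LTerm.word]

theorem action_S_known {a : A} {i : ℕ} {R : NegInfo A} (h : (.par i, .sym a) ∈ R) (p : List A)
    (t : LTerm A) :
    action (naiveMatcher A) ⟨.call .S [.word (a :: p), .cons (.par i) t], R⟩ =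
      .apply 1 (.call .S [.word (a :: p), t]) := by
  simp [h, action, naiveMatcher, tryRules, matchArgs, matchList, matchSym, compareSym, Env.empty,
    Env.bindSym, Env.bindList, Expr.instantiate, Expr.subst, LTerm.subst, STerm.subst, LTerm.word,
    Function.update]

theorem action_S_par {a : A} {i : ℕ} {R : NegInfo A}
    (h : (.par i, .sym a) ∉ R) (h' : (.sym a, .par i) ∉ R) (p : List A) (t : LTerm A) :
    action (naiveMatcher A) ⟨.call .S [.word (a :: p), .cons (.par i) t], R⟩ =
      .askSym i (.sym a) := by
  simp [h, h', action, naiveMatcher, tryRules, matchArgs, matchList, matchSym, compareSym,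
    Env.empty, Env.bindSym, Env.bindList, LTerm.word, Function.update]

theorem action_L_match (a : A) (v : List A) (t q z : LTerm A) (R : NegInfo A) :
    action (naiveMatcher A) ⟨.call .L [.word (a :: v), .cons (.sym a) t, q, z], R⟩ =
      .apply 0 (.call .L [.word v, t, q, z]) := by
  simp [action, naiveMatcher, tryRules, matchArgs, matchList, matchSym, compareSym, Env.empty,
    Env.bindSym, Env.bindList, Expr.instantiate, Expr.subst, LTerm.subst, LTerm.word,
    Function.update]

theorem action_L_mismatch {a b : A} (h : a ≠ b) (v : List A) (t q z : LTerm A) (R : NegInfo A) :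
    action (naiveMatcher A) ⟨.call .L [.word (a :: v), .cons (.sym b) t, q, z], R⟩ =
      .apply 1 (.call .S [q, z]) := by
  simp [h, action, naiveMatcher, tryRules, matchArgs, matchList, matchSym, compareSym, Env.empty,
    Env.bindSym, Env.bindList, Expr.instantiate, Expr.subst, LTerm.subst, LTerm.word,
    Function.update]

theorem action_L_nil (a : A) (v : List A) (q z : LTerm A) (R : NegInfo A) :
    action (naiveMatcher A) ⟨.call .L [.word (a :: v), .nil, q, z], R⟩ =
      .apply 2 (.call .S [q, z]) := by
  simp [action, naiveMatcher, tryRules, matchArgs, matchList, matchSym, Env.empty,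
    Env.bindSym, Env.bindList, Expr.instantiate, Expr.subst, LTerm.subst, LTerm.word,
    Function.update]

theorem action_L_var (a : A) (v : List A) (i : ℕ) (q z : LTerm A) (R : NegInfo A) :
    action (naiveMatcher A) ⟨.call .L [.word (a :: v), .var i, q, z], R⟩ = .askList i := by
  simp [action, naiveMatcher, tryRules, matchArgs, matchList, matchSym, Env.empty,
    Env.bindSym, Env.bindList, LTerm.word]

theorem action_L_known {a : A} {i : ℕ} {R : NegInfo A} (h : (.par i, .sym a) ∈ R) (v : List A)
    (t q z : LTerm A) :
    action (naiveMatcher A) ⟨.call .L [.word (a :: v), .cons (.par i) t, q, z], R⟩ =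
      .apply 1 (.call .S [q, z]) := by
  simp [h, action, naiveMatcher, tryRules, matchArgs, matchList, matchSym, compareSym, Env.empty,
    Env.bindSym, Env.bindList, Expr.instantiate, Expr.subst, LTerm.subst, LTerm.word,
    Function.update]

theorem action_L_par {a : A} {i : ℕ} {R : NegInfo A}
    (h : (.par i, .sym a) ∉ R) (h' : (.sym a, .par i) ∉ R) (v : List A) (t q z : LTerm A) :
    action (naiveMatcher A) ⟨.call .L [.word (a :: v), .cons (.par i) t, q, z], R⟩ =
      .askSym i (.sym a) := by
  simp [h, h', action, naiveMatcher, tryRules, matchArgs, matchList, matchSym, compareSym,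
    Env.empty, Env.bindSym, Env.bindList, LTerm.word, Function.update]

theorem action_L_done (t q z : LTerm A) (R : NegInfo A) :
    action (naiveMatcher A) ⟨.call .L [.nil, t, q, z], R⟩ = .apply 3 .tt := by
  simp [action, naiveMatcher, tryRules, matchArgs, matchList, Env.empty, Env.bindList,
    Expr.instantiate, Expr.subst]

end
/-! ### Unfolding of states -/

theorem Ending.restrict_config (e : Ending A) (f : Fn) (args : List (LTerm A)) (w : List A)
    (h : .prepend w e.term ∈ args) :
    Config.restrict ⟨.call f args, e.neg⟩ = ⟨.call f args, e.neg⟩ := by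
  cases e with
  | nil => rfl
  | var => rfl
  | par R =>
    refine Config.restrict_map_par _ _ _ (List.mem_flatMap.2 ⟨_, h, ?_⟩)
    simp [Ending.term, LTerm.params, STerm.params]

theorem Ending.restrict_S (e : Ending A) (π w : List A) :
    Config.restrict ⟨.call .S [.word π, .prepend w e.term], e.neg⟩ =
      (State.call_S w e).config π :=
  e.restrict_config _ _ w (by simp)

@[simp] theorem LTerm.params_word (w : List A) : (LTerm.word w).params = [] := by
  simp [LTerm.word_eq_prepend, LTerm.params]

@[simp] theorem LTerm.subst_word (σ : ℕ → STerm A) (τ : ℕ → LTerm A) (w : List A) :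
    (LTerm.word w).subst σ τ = LTerm.word w := by
  simp [LTerm.word_eq_prepend, LTerm.subst]

@[simp] theorem NegInfo.subst_nil (σ : ℕ → STerm A) : NegInfo.subst σ [] = [] := rfl

/-- After the substitution only inequalities between letters are left, all true, so any values will
do. -/
theorem Ending.satisfiable_subst {a : A} {R : List A} (h : a ∉ R) :
    (NegInfo.subst (Function.update STerm.par 0 (.sym a)) (Ending.par R).neg).Satisfiable := by
  refine ⟨fun _ => a, ?_⟩
  simp only [NegInfo.Holds, NegInfo.subst, Ending.neg, List.mem_map]
  rintro _ ⟨_, ⟨b, hb, rfl⟩, rfl⟩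
  simp only [STerm.subst, STerm.value, Function.update_self]
  rintro rfl
  exact h hb

section
variable [DecidableEq A]

theorem unfolds_of_apply {P : Program A} {C D : Config A} {k k' : ℕ} {e : Expr A}
    (h : action P C = .apply k' e) :
    Unfolds P C k D ↔ k = k' ∧ D = Config.restrict ⟨e, C.neg⟩ := by
  rw [unfolds_iff, h]

theorem unfolds_of_askList {P : Program A} {C D : Config A} {k i : ℕ}
    (h : action P C = .askList i) :
    Unfolds P C k D ↔ Unfolds P (C.narrowList i .nil) k D ∨
      Unfolds P (C.narrowList i (.cons (.par C.fresh) (.var i))) k D := by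
  rw [unfolds_iff, h]

theorem unfolds_of_askSym {P : Program A} {C D : Config A} {k i : ℕ} {b : STerm A}
    (h : action P C = .askSym i b) :
    Unfolds P C k D ↔
      ((C.narrowSym i b).neg.Satisfiable ∧ Unfolds P (C.narrowSym i b) k D) ∨
      ((C.addNe (.par i) b).neg.Satisfiable ∧ Unfolds P (C.addNe (.par i) b) k D) := by
  rw [unfolds_iff, h]

/-- Satisfiability stays as a condition because over a finite alphabet the inequalities may exclude
every letter. On a mismatch the letter parameter is dropped from the string, and its inequalities
with it. -/
theorem unfolds_S_par_iff {a : A} {p R : List A} {k : ℕ} {D : Config A} (h : a ∉ R) :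
    Unfolds (naiveMatcher A) ((State.call_S [] (.par R)).config (a :: p)) k D ↔
      k = 0 ∧ D = (State.call_L [] (a :: p) [a] .var).config (a :: p) ∨
      (Ending.par (a :: R)).neg.Satisfiable ∧ k = 1 ∧
        D = (State.call_S [] .var).config (a :: p) := by
  have hR : (STerm.par 0, STerm.sym a) ∉ (Ending.par R).neg := by simpa [Ending.neg] using h
  have hR' : (STerm.sym a, STerm.par 0) ∉ (Ending.par R).neg := by simp [Ending.neg]
  refine (unfolds_of_askSym (action_S_par hR hR' p _)).trans (or_congr ?_ ?_)
  · simp only [Config.narrowSym, Config.subst, Expr.subst, Ending.satisfiable_subst h,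
      true_and, List.map_cons,
      LTerm.subst, STerm.subst, LTerm.subst_word, List.map_nil, Function.update_self]
    rw [unfolds_of_apply (action_S_match a p _ _), Config.restrict_eq_nil _ _ (by
      simp [Expr.params, LTerm.params, STerm.params])]
    rfl
  · refine and_congr Iff.rfl ?_
    simp only [Config.addNe]
    rw [unfolds_of_apply (action_S_known List.mem_cons_self p _),
      Config.restrict_eq_nil _ _ (by simp [Expr.params, LTerm.params])]
    rfl

/-- Unlike in `S`, the letter parameter survives a mismatch inside the saved string, so inequalities
accumulate. -/
theorem unfolds_L_par_iff {a : A} {x v π R : List A} {k : ℕ} {D : Config A} (h : a ∉ R)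
    (hx : x ≠ []) :
    Unfolds (naiveMatcher A) ((State.call_L x (a :: v) [] (.par R)).config π) k D ↔
      k = 0 ∧ D = (State.call_L (x ++ [a]) v [] .var).config π ∨
      (Ending.par (a :: R)).neg.Satisfiable ∧ k = 1 ∧
        D = (State.call_S x.tail (.par (a :: R))).config π := by
  have hR : (STerm.par 0, STerm.sym a) ∉ (Ending.par R).neg := by simpa [Ending.neg] using h
  have hR' : (STerm.sym a, STerm.par 0) ∉ (Ending.par R).neg := by simp [Ending.neg]
  -- As `x` is nonempty, the tail removes a letter of `x` and not the newly known letter `a`.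
  have hz (t : LTerm A) : LTerm.prepend x.tail (.cons (.sym a) t) =
      .prepend (x ++ [a]).tail t := by
    rw [List.tail_append_of_ne_nil hx]
    simp [LTerm.prepend]
  refine (unfolds_of_askSym (action_L_par hR hR' v _ _ _)).trans (or_congr ?_ ?_)
  · simp only [Config.narrowSym, Config.subst, Expr.subst, Ending.satisfiable_subst h,
      true_and, List.map_cons,
      Ending.term, LTerm.subst, STerm.subst, LTerm.subst_word, List.map_nil,
      Function.update_self, List.append_nil, LTerm.subst_prepend, hz]
    rw [unfolds_of_apply (action_L_match a v _ _ _ _), Config.restrict_eq_nil _ _ (by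
      simp [Expr.params, LTerm.params])]
    simp [State.config, Ending.term, Ending.neg]
  · refine and_congr Iff.rfl ?_
    simp only [Config.addNe]
    rw [unfolds_of_apply (action_L_known List.mem_cons_self v _ _ _),
      ← (Ending.par (a :: R)).restrict_S]
    simp [Ending.neg, Ending.term]

theorem unfolds_S_nil_iff {π : List A} {k : ℕ} {D : Config A} :
    Unfolds (naiveMatcher A) ((State.call_S [] .nil).config π) k D ↔
      k = 2 ∧ D = State.ff.config π := by
  rw [State.config, LTerm.prepend_nil, Ending.term, unfolds_of_apply (action_S_nil _ _)]
  rfl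

theorem unfolds_L_nil_iff {a : A} {x v π : List A} {k : ℕ} {D : Config A} :
    Unfolds (naiveMatcher A) ((State.call_L x (a :: v) [] .nil).config π) k D ↔
      k = 2 ∧ D = (State.call_S x.tail .nil).config π := by
  refine (unfolds_of_apply
    (action_L_nil a v (.word π) (.prepend (x ++ []).tail .nil) [])).trans ?_
  rw [List.append_nil]
  rfl

/-- No letter parameter is present here, so the fresh index is 0 and the nonempty case is literally
the ending `.par []`. -/
theorem unfolds_S_var_iff {a : A} {p : List A} {k : ℕ} {D : Config A} :
    Unfolds (naiveMatcher A) ((State.call_S [] .var).config (a :: p)) k D ↔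
      Unfolds (naiveMatcher A) ((State.call_S [] .nil).config (a :: p)) k D ∨
      Unfolds (naiveMatcher A) ((State.call_S [] (.par [])).config (a :: p)) k D := by
  rw [State.config, LTerm.prepend_nil, Ending.term, unfolds_of_askList (action_S_var _ _ _ _)]
  simp [Config.narrowList, Config.subst, Expr.subst, LTerm.subst, State.config, Ending.term,
    Ending.neg, Config.fresh, Expr.params, NegInfo.params, LTerm.params]

theorem unfolds_L_var_iff {a : A} {x v π : List A} {k : ℕ} {D : Config A} :
    Unfolds (naiveMatcher A) ((State.call_L x (a :: v) [] .var).config π) k D ↔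
      Unfolds (naiveMatcher A) ((State.call_L x (a :: v) [] .nil).config π) k D ∨
      Unfolds (naiveMatcher A) ((State.call_L x (a :: v) [] (.par [])).config π) k D := by
  rw [State.config, LTerm.prepend_nil, Ending.term, unfolds_of_askList (action_L_var _ _ _ _ _ _)]
  simp [Config.narrowList, Config.subst, Expr.subst, LTerm.subst, State.config, Ending.term,
    Ending.neg, Config.fresh, Expr.params, NegInfo.params, LTerm.params]

theorem not_unfolds_tt {π : List A} {k : ℕ} {D : Config A} :
    ¬ Unfolds (naiveMatcher A) (State.tt.config π) k D := by
  rw [unfolds_iff]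
  exact id

theorem not_unfolds_ff {π : List A} {k : ℕ} {D : Config A} :
    ¬ Unfolds (naiveMatcher A) (State.ff.config π) k D := by
  rw [unfolds_iff]
  exact id

theorem unfolds_S_match_iff {a : A} {p w : List A} {e : Ending A} {k : ℕ} {D : Config A} :
    Unfolds (naiveMatcher A) ((State.call_S (a :: w) e).config (a :: p)) k D ↔
      k = 0 ∧ D = (State.call_L [] (a :: p) (a :: w) e).config (a :: p) := by
  rw [State.config, LTerm.prepend_cons, unfolds_of_apply (action_S_match _ _ _ _),
    e.restrict_config _ _ w (by simp)]
  rfl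

theorem unfolds_L_match_iff {a : A} {x v u π : List A} {e : Ending A} {k : ℕ} {D : Config A} :
    Unfolds (naiveMatcher A) ((State.call_L x (a :: v) (a :: u) e).config π) k D ↔
      k = 0 ∧ D = (State.call_L (x ++ [a]) v u e).config π := by
  rw [State.config, LTerm.prepend_cons, unfolds_of_apply (action_L_match _ _ _ _ _ _),
    e.restrict_config _ _ u (by simp)]
  simp [State.config]

theorem unfolds_L_done_iff {x u π : List A} {e : Ending A} {k : ℕ} {D : Config A} :
    Unfolds (naiveMatcher A) ((State.call_L x [] u e).config π) k D ↔
      k = 3 ∧ D = State.tt.config π := by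
  rw [State.config, LTerm.word, unfolds_of_apply (action_L_done _ _ _ _),
    Config.restrict_eq_nil _ _ rfl]
  rfl

/-- In a state of `L`, at least one letter of the string is known. -/
def State.Regular : State A → Prop
  | .call_L x _ u _ => x ++ u ≠ []
  | _ => True

/-- Only this inclusion is needed: `State.Step` may contain steps that do not occur, as upper bounds
on lengths and ranks are unaffected by them. -/
theorem State.Regular.exists_step {π : List A} (hπ : π ≠ []) {s : State A} (hs : s.Regular)
    {k : ℕ} {D : Config A} (h : Unfolds (naiveMatcher A) (s.config π) k D) :
    ∃ s', State.Step π s k s' ∧ D = s'.config π := by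
  obtain ⟨c, p, rfl⟩ := List.exists_cons_of_ne_nil hπ
  cases s with
  | tt => exact (not_unfolds_tt h).elim
  | ff => exact (not_unfolds_ff h).elim
  | call_S w e =>
    cases w with
    | cons b w =>
      by_cases hb : c = b
      · subst hb
        obtain ⟨rfl, rfl⟩ := unfolds_S_match_iff.1 h
        exact ⟨_, .S_match rfl, rfl⟩
      · rw [State.config, LTerm.prepend_cons, unfolds_of_apply (action_S_mismatch hb _ _ _),
          e.restrict_S] at h
        obtain ⟨rfl, rfl⟩ := h
        exact ⟨_, .S_mismatch, rfl⟩
    | nil =>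
      cases e with
      | nil =>
        obtain ⟨rfl, rfl⟩ := unfolds_S_nil_iff.1 h
        exact ⟨_, .S_nil, rfl⟩
      | var =>
        rw [unfolds_S_var_iff, unfolds_S_nil_iff, unfolds_S_par_iff List.not_mem_nil] at h
        obtain ⟨rfl, rfl⟩ | ⟨rfl, rfl⟩ | ⟨-, rfl, rfl⟩ := h
        exacts [⟨_, .S_var_nil, rfl⟩, ⟨_, .S_var_eq rfl, rfl⟩, ⟨_, .S_var_ne, rfl⟩]
      | par R =>
        by_cases hc : c ∈ R
        · have hR : (STerm.par 0, STerm.sym c) ∈ (Ending.par R).neg := by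
            simpa [Ending.neg] using hc
          rw [State.config, LTerm.prepend_nil, Ending.term,
            unfolds_of_apply (action_S_known hR _ _),
            Config.restrict_eq_nil _ _ (by simp [Expr.params, LTerm.params])] at h
          obtain ⟨rfl, rfl⟩ := h
          exact ⟨_, .S_par_ne, rfl⟩
        · rw [unfolds_S_par_iff hc] at h
          obtain ⟨rfl, rfl⟩ | ⟨-, rfl, rfl⟩ := h
          exacts [⟨_, .S_par_eq rfl, rfl⟩, ⟨_, .S_par_ne, rfl⟩]
  | call_L x v u e =>
    cases v with
    | nil =>
      obtain ⟨rfl, rfl⟩ := unfolds_L_done_iff.1 h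
      exact ⟨_, .L_done, rfl⟩
    | cons a v =>
      cases u with
      | cons b u =>
        by_cases hb : a = b
        · subst hb
          obtain ⟨rfl, rfl⟩ := unfolds_L_match_iff.1 h
          exact ⟨_, .L_match, rfl⟩
        · rw [State.config, LTerm.prepend_cons, unfolds_of_apply (action_L_mismatch hb _ _ _ _ _),
            e.restrict_S] at h
          obtain ⟨rfl, rfl⟩ := h
          exact ⟨_, .L_mismatch, rfl⟩
      | nil =>
        have hx : x ≠ [] := by simpa [State.Regular] using hs
        cases e with
        | nil =>
          obtain ⟨rfl, rfl⟩ := unfolds_L_nil_iff.1 h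
          exact ⟨_, .L_nil, rfl⟩
        | var =>
          rw [unfolds_L_var_iff, unfolds_L_nil_iff, unfolds_L_par_iff List.not_mem_nil hx] at h
          obtain ⟨rfl, rfl⟩ | ⟨rfl, rfl⟩ | ⟨-, rfl, rfl⟩ := h
          exacts [⟨_, .L_var_nil, rfl⟩, ⟨_, .L_var_eq, rfl⟩, ⟨_, .L_var_ne, rfl⟩]
        | par R =>
          by_cases hc : a ∈ R
          · have hR : (STerm.par 0, STerm.sym a) ∈ (Ending.par R).neg := by
              simpa [Ending.neg] using hc
            rw [State.config, LTerm.prepend_nil, Ending.term,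
              unfolds_of_apply (action_L_known hR _ _ _ _), ← Ending.term.eq_3 R,
              Ending.restrict_S, List.append_nil] at h
            obtain ⟨rfl, rfl⟩ := h
            exact ⟨_, .L_par_known, rfl⟩
          · rw [unfolds_L_par_iff hc hx] at h
            obtain ⟨rfl, rfl⟩ | ⟨-, rfl, rfl⟩ := h
            exacts [⟨_, .L_par_eq, rfl⟩, ⟨_, .L_par_ne hc, rfl⟩]

end

/-! ### Reachable states -/

/-- Without repetitions and with letters from the pattern, `R` ranges over a finite set even if the
alphabet is infinite. -/
def Ending.Valid (π : List A) : Ending A → Prop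
  | .par R => R ⊆ π ∧ R.Nodup
  | _ => True

def Ending.length : Ending A → ℕ
  | .par _ => 1
  | _ => 0

/-- A superset of the reachable states. -/
def State.Valid (π : List A) : State A → Prop
  | .call_S w e => w ⊆ π ∧ w.length + e.length ≤ π.length ∧ e.Valid π
  | .call_L x v u e => x ++ v = π ∧ x ++ u ≠ [] ∧ u ⊆ π ∧
      x.length + u.length + e.length ≤ π.length ∧ e.Valid π
  | _ => True

/-- The length of the known part of the string, from the current alignment on. -/
def State.length (π : List A) : State A → ℕ
  | .call_S w e => w.length + e.length
  | .call_L x _ u e => x.length + u.length + e.length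
  | .tt => π.length
  | .ff => 0

/-- A measure that decreases in every step without a question about the unknown rest of the
string. -/
def State.rank (π : List A) : State A → ℕ
  | .call_S w e => (w.length + e.length) * (π.length + 2) + (π.length + 1)
  | .call_L x v u e => (x.length + u.length + e.length) * (π.length + 2) + v.length
  | _ => 0

/-- The states of the path on which the whole pattern matches at once. -/
def State.main : List A → List A → State A
  | _, [] => .tt
  | [], _ :: _ => .call_S [] .var
  | b :: x, a :: v => .call_L (b :: x) (a :: v) [] .var

theorem State.main_nil_cons (a : A) (v : List A) : State.main [] (a :: v) = .call_S [] .var := rfl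

theorem State.main_cons_cons (b : A) (x : List A) (a : A) (v : List A) :
    State.main (b :: x) (a :: v) = .call_L (b :: x) (a :: v) [] .var := rfl

/-- The final state `.tt` is excluded; among valid states these are exactly the ones that ask about
the unknown rest of the string. -/
def State.IsMain (π : List A) (s : State A) : Prop :=
  ∃ x a v, x ++ a :: v = π ∧ s = .main x (a :: v)

theorem State.valid_main {π x v : List A} (h : x ++ v = π) : (State.main x v).Valid π := by
  subst h
  cases v with
  | nil => trivial
  | cons a v => cases x <;> simp [State.main, State.Valid, Ending.Valid, Ending.length]

/-- Giving `.tt` the length of the pattern is what makes this hold also for `v = []`. -/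
theorem State.length_main {π x v : List A} (h : x ++ v = π) :
    (State.main x v).length π = x.length := by
  subst h
  cases v with
  | nil => simp [State.main, State.length]
  | cons a v => cases x <;> simp [State.main, State.length, Ending.length]

theorem tail_append_subset {x u v π : List A} (h : x ++ v = π) (hu : u ⊆ π) :
    (x ++ u).tail ⊆ π :=
  List.Subset.trans (List.tail_subset _)
    (List.append_subset.2 ⟨h ▸ List.subset_append_left _ _, hu⟩)

theorem tail_subset_of_append_eq {x v π : List A} (h : x ++ v = π) : x.tail ⊆ π :=
  List.Subset.trans (List.tail_subset _) (h ▸ List.subset_append_left _ _)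

theorem State.Step.valid {π : List A} {s s' : State A} {k : ℕ} (h : Step π s k s')
    (hs : s.Valid π) : s'.Valid π := by
  cases h with
  | S_match h => simp_all [State.Valid]
  | S_mismatch =>
    simp only [State.Valid, List.cons_subset, List.length_cons] at hs ⊢
    exact ⟨hs.1.2, by omega, hs.2.2⟩
  | S_nil | S_var_nil | L_done => trivial
  | S_par_eq h | S_var_eq h => subst h; simp [State.Valid, Ending.Valid, Ending.length]
  | S_par_ne | S_var_ne => simp [State.Valid, Ending.Valid, Ending.length]
  | L_match =>
    simp only [State.Valid, List.cons_subset, List.length_cons, List.append_assoc,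
      List.cons_append, List.nil_append, List.length_append, List.length_nil] at hs ⊢
    exact ⟨hs.1, by simp, hs.2.2.1.2, by omega, hs.2.2.2.2⟩
  | L_mismatch =>
    obtain ⟨h1, h2, h3, h4, h5⟩ := hs
    refine ⟨tail_append_subset h1 h3, ?_, h5⟩
    rw [List.length_tail, List.length_append]
    omega
  | L_nil | L_var_nil =>
    obtain ⟨h1, h2, h3, h4, h5⟩ := hs
    refine ⟨tail_subset_of_append_eq h1, ?_, trivial⟩
    simp only [List.length_tail, Ending.length]
    omega
  | L_par_known =>
    obtain ⟨h1, h2, h3, h4, h5⟩ := hs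
    refine ⟨tail_subset_of_append_eq h1, ?_, h5⟩
    simp only [List.length_tail, Ending.length, List.length_nil] at h4 ⊢
    omega
  | L_par_eq | L_var_eq =>
    obtain ⟨h1, h2, h3, h4, h5⟩ := hs
    -- The letter `a` of the pattern lies beyond `x`, which leaves room for one more known letter.
    have := congrArg List.length h1
    simp only [List.length_append, List.length_cons] at this
    refine ⟨by simpa using h1, by simp, by simp, ?_, trivial⟩
    simp only [Ending.length, List.length_nil, List.length_append, List.length_cons]
    omega
  | L_par_ne h =>
    obtain ⟨h1, h2, h3, h4, h5⟩ := hs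
    refine ⟨tail_subset_of_append_eq h1, ?_,
      List.cons_subset.2 ⟨by simp [← h1], h5.1⟩, List.nodup_cons.2 ⟨h, h5.2⟩⟩
    simp only [List.length_tail, Ending.length, List.length_nil] at h4 ⊢
    omega
  | L_var_ne =>
    obtain ⟨h1, h2, h3, h4, h5⟩ := hs
    have := congrArg List.length h1
    simp only [List.length_append, List.length_cons] at this
    refine ⟨tail_subset_of_append_eq h1, ?_, by simp [← h1], by simp⟩
    simp only [List.length_tail, Ending.length]
    omega

/-- The rank encodes a lexicographic order: the second component stays below the factor `m + 2`, so
a shorter length always wins. -/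
theorem rank_lt_of_length_lt {a b m c d : ℕ} (h : a + 1 ≤ b) (hc : c ≤ m + 1) :
    a * (m + 2) + c < b * (m + 2) + d := by
  nlinarith [Nat.mul_le_mul_right (m + 2) h]

/-- A mismatch or the end of the string costs a known letter. A match keeps the length and shortens
the rest of the pattern; starting a comparison keeps the length and passes from second component
`|π| + 1` to `|π|`. -/
theorem State.Step.length_le_and_rank_lt {π : List A} (hπ : π ≠ []) {s s' : State A} {k : ℕ}
    (h : Step π s k s') (hs : s.Valid π) (hm : ¬ s.IsMain π) :
    s'.length π ≤ s.length π ∧ s'.rank π < s.rank π := by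
  have hπ' := List.length_pos_of_ne_nil hπ
  cases h with
  | S_match h => simp [State.length, State.rank]
  | S_mismatch =>
    refine ⟨by simp [State.length], rank_lt_of_length_lt ?_ le_rfl⟩
    simp only [List.length_cons]
    omega
  | S_nil => simp [State.length, State.rank]
  | S_par_eq h => simp [State.length, State.rank, Ending.length]
  | S_par_ne => simp [State.length, State.rank, Ending.length]
  | S_var_nil | S_var_eq | S_var_ne =>
    obtain ⟨c, p, rfl⟩ := List.exists_cons_of_ne_nil hπ
    exact (hm ⟨[], c, p, rfl, rfl⟩).elim
  | L_done =>
    obtain ⟨h1, h2, h3, h4, h5⟩ := hs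
    rw [List.append_nil] at h1
    subst h1
    -- The whole pattern has been matched, so at least `|π|` letters were known already.
    refine ⟨by simp only [State.length]; omega, ?_⟩
    simp only [State.rank]
    positivity
  | @L_match x _ v u e =>
    simp only [State.length, State.rank, List.length_append, List.length_cons, List.length_nil]
    refine ⟨by omega, ?_⟩
    rw [zero_add, add_assoc x.length, add_comm 1 u.length]
    exact Nat.lt_succ_self _
  | L_mismatch =>
    refine ⟨?_, rank_lt_of_length_lt ?_ le_rfl⟩ <;>
      simp only [State.length, List.length_tail, List.length_append, List.length_cons] <;> omega
  | L_nil | L_par_known | L_par_ne =>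
    obtain ⟨h1, h2, h3, h4, h5⟩ := hs
    -- The matched part `x` is nonempty, so passing to its tail really loses a letter.
    have := List.length_pos_of_ne_nil h2
    simp only [List.append_nil] at this
    refine ⟨?_, rank_lt_of_length_lt ?_ le_rfl⟩ <;>
      simp only [State.length, List.length_tail, List.length_nil, Ending.length] <;> omega
  | L_par_eq => simp [State.length, State.rank, Ending.length]
  | L_var_nil | L_var_eq | L_var_ne =>
    obtain ⟨h1, h2, h3, h4, h5⟩ := hs
    rw [List.append_nil] at h2
    obtain ⟨c, p, rfl⟩ := List.exists_cons_of_ne_nil h2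
    exact (hm ⟨c :: p, _, _, h1, rfl⟩).elim

theorem State.Valid.regular {π : List A} {s : State A} (h : s.Valid π) : s.Regular := by
  cases s with
  | call_L => exact h.2.1
  | _ => trivial

/-! ### Finiteness of the set of valid states -/

theorem finite_setOf_subset_length_le (π : List A) (n : ℕ) :
    {l : List A | l ⊆ π ∧ l.length ≤ n}.Finite := by
  have : Finite {a // a ∈ π} := π.finite_toSet
  refine ((List.finite_length_le {a // a ∈ π} n).image (List.map Subtype.val)).subset ?_
  rintro l ⟨h, hn⟩
  exact ⟨l.attachWith (· ∈ π) fun a ha => h ha, by simpa using hn,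
    List.attachWith_map_subtype_val _⟩

theorem Ending.finite_setOf_valid (π : List A) : {e : Ending A | e.Valid π}.Finite := by
  refine (((finite_setOf_subset_length_le π π.length).image Ending.par).union
    (Set.toFinite {.nil, .var})).subset ?_
  rintro (_ | _ | R) h
  · simp
  · simp
  · exact .inl ⟨R, ⟨h.1, (List.subperm_of_subset h.2 h.1).length_le⟩, rfl⟩

theorem State.finite_setOf_valid (π : List A) : {s : State A | s.Valid π}.Finite := by
  have h := finite_setOf_subset_length_le π π.length
  have h' := Ending.finite_setOf_valid π
  refine ((((h.prod h').image fun q => State.call_S q.1 q.2).union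
    ((h.prod (h.prod (h.prod h'))).image fun q => State.call_L q.1 q.2.1 q.2.2.1 q.2.2.2)).union
    (Set.toFinite {.tt, .ff})).subset ?_
  rintro (⟨w, e⟩ | ⟨x, v, u, e⟩ | _ | _) hs
  · obtain ⟨h1, h2, h3⟩ := hs
    exact .inl (.inl ⟨(w, e), ⟨⟨h1, show w.length ≤ _ by omega⟩, h3⟩, rfl⟩)
  · obtain ⟨rfl, h2, h3, h4, h5⟩ := hs
    exact .inl (.inr ⟨(x, v, u, e), ⟨⟨by simp, by simp⟩, ⟨by simp, by simp⟩,
      ⟨h3, show u.length ≤ _ by omega⟩, h5⟩, rfl⟩)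
  · simp
  · simp

/-! ### The main path -/

/-- A rule other than number 0 leaves the main path. For nonempty `x` the shift drops one letter,
which compensates for the unknown letter that the mismatch adds. -/
theorem State.Step.length_le_of_main {π x v : List A} {a : A} (h : x ++ a :: v = π) {k : ℕ}
    {s : State A} (hs : Step π (.main x (a :: v)) (k + 1) s) : s.length π ≤ x.length := by
  cases x with
  | nil =>
    rw [main_nil_cons] at hs
    cases hs <;> simp [State.length, Ending.length]
  | cons b x =>
    rw [main_cons_cons] at hs
    cases hs <;> simp [State.length, Ending.length]

theorem entry_eq_main {π : List A} (hπ : π ≠ []) : entry π = (State.main [] π).config π := by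
  obtain ⟨a, p, rfl⟩ := List.exists_cons_of_ne_nil hπ
  rfl

/-- The numbers of the rules applied along the edge of the main path from the matched part `x` of
the pattern, where `v` is the rest of the pattern after the next letter. -/
def mainLabels (x v : List A) : List ℕ :=
  (if x = [] then [0, 0] else [0]) ++ if v = [] then [3] else []

/-- The path on which the whole pattern matches at once, from the node where the part `x` of the
pattern has been matched and the part `v` is left. -/
def mainPath (π : List A) : List A → List A → TreePath A
  | _, [] => []
  | x, a :: v =>
    (mainLabels x v, (State.main (x ++ [a]) v).config π) :: mainPath π (x ++ [a]) v

theorem length_mainPath (π x v : List A) : (mainPath π x v).length = v.length := by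
  induction v generalizing x with
  | nil => rfl
  | cons a v ih => simp [mainPath, ih]

/-! ### Edges -/

section
variable [DecidableEq A]

theorem Pivot.not_transient {P : Program A} {C : Config A} (h : Pivot P C) : ¬ Transient P C := by
  rintro ⟨_, -, h'⟩
  obtain ⟨e, e', hne, he, he'⟩ := h
  exact hne ((h' e he).trans (h' e' he').symm)

/-- The steps `ks` through transient nodes lead from the node `C` to the first node `D` that is not
transient. -/
def Arrives (P : Program A) (C : Config A) (ks : List ℕ) (D : Config A) : Prop :=
  ¬ Transient P C ∧ ks = [] ∧ D = C ∨ Transient P C ∧ Edge P C ks D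

theorem edge_iff {P : Program A} {C E : Config A} {ks : List ℕ} :
    Edge P C ks E ↔ ∃ k D ks', Unfolds P C k D ∧ ks = k :: ks' ∧ Arrives P D ks' E := by
  constructor
  · rintro (⟨h, h'⟩ | ⟨h, h', h''⟩)
    · exact ⟨_, _, _, h, rfl, .inl ⟨h', rfl, rfl⟩⟩
    · exact ⟨_, _, _, h, rfl, .inr ⟨h', h''⟩⟩
  · rintro ⟨k, D, ks', h, rfl, ⟨h', rfl, rfl⟩ | ⟨h', h''⟩⟩
    exacts [.last h h', .skip h h' h'']

theorem arrives_iff_of_unfolds_iff {P : Program A} {C C' E : Config A} {k' : ℕ} {ks : List ℕ}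
    (h : ∀ k D, Unfolds P C k D ↔ k = k' ∧ D = C') :
    Arrives P C ks E ↔ ∃ ks', ks = k' :: ks' ∧ Arrives P C' ks' E := by
  have hC : Transient P C :=
    ⟨(k', C'), (h _ _).2 ⟨rfl, rfl⟩, fun e he => Prod.ext_iff.2 ((h _ _).1 he)⟩
  simp [Arrives, hC, edge_iff (C := C), h]

theorem arrives_iff_of_not_transient {P : Program A} {C E : Config A} {ks : List ℕ}
    (h : ¬ Transient P C) : Arrives P C ks E ↔ ks = [] ∧ E = C := by
  simp [Arrives, h]

/-- The edges for the empty rest (rule 2) and for the right letter (rule 0) exist over every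
alphabet; the mismatch edge may be missing. -/
theorem pivot_main {π x v : List A} {a : A} (h : x ++ a :: v = π) :
    Pivot (naiveMatcher A) ((State.main x (a :: v)).config π) := by
  subst h
  cases x with
  | nil =>
    exact ⟨(0, _), (2, _), by simp,
      unfolds_S_var_iff.2 (.inr ((unfolds_S_par_iff List.not_mem_nil).2 (.inl ⟨rfl, rfl⟩))),
      unfolds_S_var_iff.2 (.inl (unfolds_S_nil_iff.2 ⟨rfl, rfl⟩))⟩
  | cons b x =>
    exact ⟨(0, _), (2, _), by simp,
      unfolds_L_var_iff.2 (.inr ((unfolds_L_par_iff List.not_mem_nil (by simp)).2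
        (.inl ⟨rfl, rfl⟩))),
      unfolds_L_var_iff.2 (.inl (unfolds_L_nil_iff.2 ⟨rfl, rfl⟩))⟩

theorem not_transient_tt {π : List A} : ¬ Transient (naiveMatcher A) (State.tt.config π) :=
  fun ⟨_, h, _⟩ => not_unfolds_tt h

theorem not_edge_tt {π : List A} {ks : List ℕ} {D : Config A} :
    ¬ Edge (naiveMatcher A) (State.tt.config π) ks D := fun h => by
  obtain ⟨_, _, _, h, -⟩ := edge_iff.1 h
  exact not_unfolds_tt h

theorem not_isMain_of_transient {π : List A} {s : State A}
    (h : Transient (naiveMatcher A) (s.config π)) : ¬ s.IsMain π := by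
  rintro ⟨x, a, v, hx, rfl⟩
  exact (pivot_main hx).not_transient h

/-- The nodes removed along an edge are transient, while main states are pivots; so no main state is
skipped and the bounds for single steps compose. -/
theorem State.Valid.exists_edge {π : List A} (hπ : π ≠ []) {s : State A} (hs : s.Valid π)
    (hm : ¬ s.IsMain π) {ks : List ℕ} {D : Config A} (h : Edge (naiveMatcher A) (s.config π) ks D) :
    ∃ s' : State A, D = s'.config π ∧ s'.Valid π ∧ s'.length π ≤ s.length π ∧
      s'.rank π < s.rank π := by
  generalize hC : s.config π = C at h
  induction h generalizing s with
  | last h _ =>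
    subst hC
    obtain ⟨s', h', rfl⟩ := hs.regular.exists_step hπ h
    exact ⟨s', rfl, h'.valid hs, h'.length_le_and_rank_lt hπ hs hm⟩
  | skip h ht _ ih =>
    subst hC
    obtain ⟨s', h', rfl⟩ := hs.regular.exists_step hπ h
    obtain ⟨h1, h2⟩ := h'.length_le_and_rank_lt hπ hs hm
    obtain ⟨s'', h3, h4, h5, h6⟩ := ih (h'.valid hs) (not_isMain_of_transient ht) rfl
    exact ⟨s'', h3, h4, h5.trans h1, h6.trans h2⟩

theorem arrives_main_iff {π x v : List A} (hx : x ≠ []) (h : x ++ v = π) {ks : List ℕ}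
    {D : Config A} :
    Arrives (naiveMatcher A) ((State.call_L x v [] .var).config π) ks D ↔
      (ks = if v = [] then [3] else []) ∧ D = (State.main x v).config π := by
  cases v with
  | nil =>
    rw [arrives_iff_of_unfolds_iff fun _ _ => unfolds_L_done_iff]
    simp [arrives_iff_of_not_transient not_transient_tt, State.main]
  | cons a v =>
    obtain ⟨b, x, rfl⟩ := List.exists_cons_of_ne_nil hx
    refine (arrives_iff_of_not_transient (pivot_main h).not_transient).trans ?_
    simp

/-- From the root, rule 0 of `S` is followed by a transient application of rule 0 of `L`; after the
last letter of the pattern, rule 3 follows transiently. Hence the shape of `mainLabels`. -/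
theorem exists_unfolds_zero_main_iff {π x v : List A} {a : A} (h : x ++ a :: v = π) {ks : List ℕ}
    {D : Config A} :
    (∃ C ks', Unfolds (naiveMatcher A) ((State.main x (a :: v)).config π) 0 C ∧ ks = 0 :: ks' ∧
        Arrives (naiveMatcher A) C ks' D) ↔
      ks = mainLabels x v ∧ D = (State.main (x ++ [a]) v).config π := by
  subst h
  cases x with
  | nil =>
    simp only [State.main_nil_cons, List.nil_append, unfolds_S_var_iff, unfolds_S_nil_iff,
      unfolds_S_par_iff List.not_mem_nil]
    simp [arrives_iff_of_unfolds_iff fun _ _ => unfolds_L_match_iff,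
      arrives_main_iff (List.cons_ne_nil a []), mainLabels]
  | cons b x =>
    simp only [State.main_cons_cons, unfolds_L_var_iff, unfolds_L_nil_iff,
      unfolds_L_par_iff List.not_mem_nil (List.cons_ne_nil b x)]
    simp [arrives_main_iff , mainLabels]

/-- The edge of the main path. -/
theorem edge_main {π x v : List A} {a : A} (h : x ++ a :: v = π) :
    Edge (naiveMatcher A) ((State.main x (a :: v)).config π) (mainLabels x v)
      ((State.main (x ++ [a]) v).config π) := by
  obtain ⟨C, ks, h1, h2, h3⟩ := (exists_unfolds_zero_main_iff h).2 ⟨rfl, rfl⟩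
  exact edge_iff.2 ⟨0, C, ks, h1, h2, h3⟩

/-- The edges from a node of the main path: its next edge, and edges to states that are not farther
along the main path. -/
theorem eq_or_exists_of_edge_main {π x v : List A} {a : A} (h : x ++ a :: v = π) {ks : List ℕ}
    {D : Config A} (hD : Edge (naiveMatcher A) ((State.main x (a :: v)).config π) ks D) :
    ks = mainLabels x v ∧ D = (State.main (x ++ [a]) v).config π ∨
      (∃ k ks', ks = (k + 1) :: ks') ∧
        ∃ s : State A, D = s.config π ∧ s.Valid π ∧ s.length π ≤ x.length := by
  have hπ : π ≠ [] := by simp [← h]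
  have hv := State.valid_main h
  -- The number of the first rule decides: 0 stays on the main path, any other number leaves it.
  obtain ⟨_ | k, C, ks', h1, h2, h3⟩ := edge_iff.1 hD
  · exact .inl ((exists_unfolds_zero_main_iff h).1 ⟨C, ks', h1, h2, h3⟩)
  · obtain ⟨s, hs, rfl⟩ := hv.regular.exists_step hπ h1
    refine .inr ⟨⟨k, ks', h2⟩, ?_⟩
    obtain ⟨-, -, rfl⟩ | ⟨ht, hE⟩ := h3
    · exact ⟨s, rfl, hs.valid hv, hs.length_le_of_main h⟩
    · obtain ⟨s', h4, h5, h6, -⟩ :=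
        (hs.valid hv).exists_edge hπ (not_isMain_of_transient ht) hE
      exact ⟨s', h4, h5, h6.trans (hs.length_le_of_main h)⟩

/-- Only the edge along the main path can gain a letter. Summed over a path, this bounds from below
the number of edges needed to reach T. -/
theorem State.Valid.exists_edge_length_le {π : List A} (hπ : π ≠ []) {s : State A}
    (hs : s.Valid π) {ks : List ℕ} {D : Config A}
    (h : Edge (naiveMatcher A) (s.config π) ks D) :
    ∃ s' : State A, D = s'.config π ∧ s'.Valid π ∧ s'.length π ≤ s.length π + 1 := by
  by_cases hm : s.IsMain π
  · obtain ⟨x, a, v, hx, rfl⟩ := hm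
    rw [State.length_main hx]
    obtain ⟨-, rfl⟩ | ⟨-, s', rfl, h1, h2⟩ := eq_or_exists_of_edge_main hx h
    · have hx' : (x ++ [a]) ++ v = π := by simpa using hx
      exact ⟨_, rfl, State.valid_main hx', by simp [State.length_main hx']⟩
    · exact ⟨s', rfl, h1, h2.trans (Nat.le_succ _)⟩
  · obtain ⟨s', h1, h2, h3, -⟩ := hs.exists_edge hπ hm h
    exact ⟨s', h1, h2, h3.trans (Nat.le_succ _)⟩

/-! ### Paths -/

theorem State.Valid.exists_target {π : List A} (hπ : π ≠ []) {s : State A} (hs : s.Valid π)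
    {p : TreePath A} (h : IsPath (naiveMatcher A) (s.config π) p) :
    ∃ s' : State A, TreePath.target (s.config π) p = s'.config π ∧ s'.Valid π ∧
      s'.length π ≤ s.length π + p.length := by
  induction p generalizing s with
  | nil => exact ⟨s, rfl, hs, le_rfl⟩
  | cons e p ih =>
    obtain ⟨ks, D⟩ := e
    obtain ⟨s', rfl, h1, h2⟩ := hs.exists_edge_length_le hπ h.1
    obtain ⟨s'', h3, h4, h5⟩ := ih h1 h.2
    exact ⟨s'', h3, h4, by simp only [List.length_cons]; omega⟩

theorem State.Valid.exists_infinitePath {π : List A} (hπ : π ≠ []) {s : State A} (hs : s.Valid π)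
    {r : ℕ → Config A} (h : IsInfinitePath (naiveMatcher A) (s.config π) r) (n : ℕ) :
    ∃ s' : State A, r n = s'.config π ∧ s'.Valid π := by
  induction n with
  | zero => exact ⟨s, h.1, hs⟩
  | succ n ih =>
    obtain ⟨s', h1, h2⟩ := ih
    obtain ⟨ks, hE⟩ := h.2 n
    rw [h1] at hE
    obtain ⟨s'', h3, h4, -⟩ := h2.exists_edge_length_le hπ hE
    exact ⟨s'', h3, h4⟩

/-- Every infinite path from a state returns to a node of the main path which is not farther. -/
theorem State.Valid.exists_main {π : List A} (hπ : π ≠ []) {s : State A} (hs : s.Valid π)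
    {r : ℕ → Config A} (h : IsInfinitePath (naiveMatcher A) (s.config π) r) :
    ∃ n x v, x ++ v = π ∧ x.length ≤ s.length π ∧ r n = (State.main x v).config π := by
  induction hk : s.rank π using Nat.strong_induction_on generalizing s r with
  | _ k ih =>
    by_cases hm : s.IsMain π
    · obtain ⟨x, a, v, hx, rfl⟩ := hm
      exact ⟨0, x, a :: v, hx, (State.length_main hx).ge, h.1⟩
    · obtain ⟨ks, hE⟩ := h.2 0
      rw [h.1] at hE
      obtain ⟨s', h1, h2, h3, h4⟩ := hs.exists_edge hπ hm hE
      -- The induction hypothesis is applied to the infinite path without its first node, as the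
      -- rank has dropped.
      obtain ⟨n, x, v, h5, h6, h7⟩ :=
        ih _ (hk ▸ h4) (r := fun n => r (n + 1)) h2 ⟨h1, fun n => h.2 (n + 1)⟩ rfl
      exact ⟨n + 1, x, v, h5, h6.trans h3, h7⟩

theorem isTruePath_mainPath {π x v : List A} (h : x ++ v = π) :
    IsTruePath (naiveMatcher A) ((State.main x v).config π) (mainPath π x v) := by
  induction v generalizing x with
  | nil => exact ⟨trivial, rfl⟩
  | cons a v ih =>
    obtain ⟨h1, h2⟩ := ih (x := x ++ [a]) (by simpa using h)
    exact ⟨⟨edge_main h, h1⟩, h2⟩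

/-- Up to the point of separation both label sequences agree; there the main path continues with 0
and the other path with a positive number. -/
theorem lex_mainPath {π x v : List A} (h : x ++ v = π) {p : TreePath A}
    (hp : IsTruePath (naiveMatcher A) ((State.main x v).config π) p) (hne : p ≠ mainPath π x v) :
    List.Lex (· < ·) (TreePath.ruleNumbers (mainPath π x v)) (TreePath.ruleNumbers p) := by
  induction v generalizing x p with
  | nil =>
    cases p with
    | nil => exact (hne rfl).elim
    | cons e p => exact (not_edge_tt hp.1.1).elim
  | cons a v ih =>
    cases p with
    | nil =>
      have := hp.2
      cases x <;> cases this
    | cons e p =>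
      obtain ⟨ks, D⟩ := e
      obtain ⟨⟨hE, hp1⟩, hp2⟩ := hp
      simp only [TreePath.ruleNumbers, mainPath, List.flatMap_cons]
      obtain ⟨rfl, rfl⟩ | ⟨⟨k, ks', rfl⟩, -⟩ := eq_or_exists_of_edge_main h hE
      · refine List.Lex.append_left _ (ih (by simpa using h) ⟨hp1, hp2⟩ ?_) _
        rintro rfl
        exact hne rfl
      · cases x <;> exact .rel (Nat.succ_pos k)

theorem not_pivot_tt {π : List A} : ¬ Pivot (naiveMatcher A) (State.tt.config π) :=
  fun ⟨_, _, _, h, _⟩ => not_unfolds_tt h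

/-- The last pivot along a prefix of the main path. -/
theorem exists_isLastPivot_mainPath {π x v : List A} (h : x ++ v = π) (hv : v ≠ [])
    {Ψ : TreePath A} (hΨ : Ψ <+: mainPath π x v) :
    ∃ q x' a v', x' ++ a :: v' = π ∧
      IsLastPivot (naiveMatcher A) ((State.main x v).config π) q Ψ ∧
      TreePath.target ((State.main x v).config π) q = (State.main x' (a :: v')).config π ∧
      q ++ [(mainLabels x' v', (State.main (x' ++ [a]) v').config π)] <+: mainPath π x v ∧
      ∀ y w, y ++ w = π → x.length ≤ y.length → y.length ≤ x'.length →
        (State.main y w).config π ∈ TreePath.configs ((State.main x v).config π) Ψ := by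
  induction v generalizing x Ψ with
  | nil => exact (hv rfl).elim
  | cons a v ih =>
    -- A main state is determined by the length of its matched part, a prefix of `π`.
    have hself (y w) (hy : y ++ w = π) (h1 : x.length ≤ y.length) (h2 : y.length ≤ x.length) :
        State.main y w = State.main x (a :: v) := by
      obtain ⟨rfl, rfl⟩ := List.append_inj (hy.trans h.symm) (h2.antisymm h1)
      rfl
    cases Ψ with
    | nil =>
      refine ⟨[], x, a, v, h, ⟨List.prefix_rfl, pivot_main h, ?_⟩, rfl, ?_, ?_⟩
      · intro q' _ h1 h2
        exact (h2 (List.prefix_nil.1 h1)).elim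
      · simp [mainPath]
      · intro y w hy h1 h2
        simp [TreePath.configs, hself y w hy h1 h2]
    | cons e Ψ =>
      rw [mainPath, List.cons_prefix_cons] at hΨ
      obtain ⟨rfl, hΨ⟩ := hΨ
      have h' : (x ++ [a]) ++ v = π := by simpa using h
      -- If no pattern is left, the next node is the leaf T and not a pivot, so the last pivot is
      -- the current node.
      by_cases hv' : v = []
      · subst hv'
        rw [mainPath, List.prefix_nil] at hΨ
        subst hΨ
        refine ⟨[], x, a, [], h, ⟨List.nil_prefix, pivot_main h, ?_⟩, rfl, ?_, ?_⟩
        · intro q' _ h1 h2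
          obtain ⟨e, q', rfl⟩ := List.exists_cons_of_ne_nil h2
          rw [List.cons_prefix_cons, List.prefix_nil] at h1
          obtain ⟨rfl, rfl⟩ := h1
          exact not_pivot_tt (π := π)
        · simp [mainPath]
        · intro y w hy h1 h2
          simp [TreePath.configs, hself y w hy h1 h2]
      · obtain ⟨q, x', a', v', h1, ⟨h2, h3, h4⟩, h5, h6, h7⟩ := ih h' hv' hΨ
        refine ⟨(mainLabels x v, (State.main (x ++ [a]) v).config π) :: q, x', a', v', h1,
          ⟨List.cons_prefix_cons.2 ⟨rfl, h2⟩, h3, ?_⟩, h5, ?_, ?_⟩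
        · intro q' hq hq' hne
          cases q' with
          | nil => simp at hq
          | cons e q' =>
            obtain ⟨rfl, hq1⟩ := List.cons_prefix_cons.1 hq
            exact h4 q' hq1 (List.cons_prefix_cons.1 hq').2 fun h => hne (h ▸ rfl)
        · rw [mainPath, List.cons_append, List.cons_prefix_cons]
          exact ⟨rfl, h6⟩
        · intro y w hy hxy hyx
          obtain hlt | hge := Nat.lt_or_ge x.length y.length
          · exact List.mem_cons_of_mem _ (h7 y w hy (by simpa using hlt) hyx)
          · simp [TreePath.configs, hself y w hy hxy hge]

end

end Unfolding

open Unfolding in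
theorem mainTheorem1 {A : Type*} [DecidableEq A] (π : List A) (hπ : π ≠ []) :
    -- the first path from the root to a leaf labelled `T`, which is a shortest one
    (∃ t : TreePath A, IsFirstTruePath (naiveMatcher A) (entry π) t ∧
      (∀ p : TreePath A, IsTruePath (naiveMatcher A) (entry π) p → t.length ≤ p.length) ∧
      -- every prefix of it covers every subtree that branches off at the last pivot
      ∀ Ψ : TreePath A, Ψ <+: t →
        ∃ q : TreePath A, IsLastPivot (naiveMatcher A) (entry π) q Ψ ∧
          ∀ (ks : List ℕ) (D : Config A),
            Edge (naiveMatcher A) (TreePath.target (entry π) q) ks D →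
            ¬ (q ++ [(ks, D)] <+: t) →
            SegmentCoversSubtree (naiveMatcher A) (TreePath.configs (entry π) Ψ) D) ∧
    -- on every infinite path some configuration is covered by an earlier one
    (∀ r : ℕ → Config A, IsInfinitePath (naiveMatcher A) (entry π) r →
      ∃ m n, m < n ∧ (r m).Covers (r n)) ∧
    -- there are finitely many configurations up to renaming of parameters
    (∃ Z : Set (Config A), Z.Finite ∧
      ∀ p : TreePath A, IsPath (naiveMatcher A) (entry π) p →
        ∃ C ∈ Z, C.Covers (TreePath.target (entry π) p) ∧
          (TreePath.target (entry π) p).Covers C) := by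
  have hroot : [] ++ π = π := rfl
  have hval := State.valid_main hroot
  have hfin := (State.finite_setOf_valid π).image (State.config π)
  rw [entry_eq_main hπ]
  refine ⟨⟨mainPath π [] π, ⟨isTruePath_mainPath hroot, fun p => lex_mainPath hroot⟩, ?_, ?_⟩, ?_,
    _, hfin, ?_⟩
  · rintro p ⟨hp, htt⟩
    obtain ⟨s, hs, -, hlen⟩ := hval.exists_target hπ hp
    rw [hs] at htt
    -- Only `.tt` remains, whose length `|π|` is bounded by the number of edges since the root has
    -- length 0.
    cases s <;> try cases htt
    rw [State.length_main hroot] at hlen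
    simpa [State.length, length_mainPath] using hlen
  · intro Ψ hΨ
    obtain ⟨q, x, a, v, hx, hq, htarget, hpre, hmem⟩ := exists_isLastPivot_mainPath hroot hπ hΨ
    refine ⟨q, hq, fun ks D hE hD r hr => ?_⟩
    rw [htarget] at hE
    obtain ⟨rfl, rfl⟩ | ⟨-, s, rfl, hs, hlen⟩ := eq_or_exists_of_edge_main hx hE
    · exact (hD hpre).elim
    · obtain ⟨n, y, w, hy, hylen, hn⟩ := hs.exists_main hπ hr
      -- The main state met again has a matched part no longer than that of the last pivot, so it
      -- occurs along `Ψ`.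
      exact ⟨n, _, hmem y w hy (Nat.zero_le _) (hylen.trans hlen), hn ▸ Config.covers_refl _⟩
  · intro r hr
    -- Pigeonhole: an infinite path within a finite set of configurations repeats one of them
    -- exactly.
    obtain ⟨m, n, hmn, heq⟩ := hfin.exists_lt_map_eq_of_forall_mem (f := r) fun n => by
      obtain ⟨s, hs, hs'⟩ := hval.exists_infinitePath hπ hr n
      exact ⟨s, hs', hs.symm⟩
    exact ⟨m, n, hmn, heq ▸ Config.covers_refl _⟩
  · intro p hp
    obtain ⟨s, hs, hs', -⟩ := hval.exists_target hπ hp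
    exact ⟨_, ⟨s, hs', rfl⟩, hs ▸ Config.covers_refl _, hs ▸ Config.covers_refl _⟩
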